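/- Let $\mathcal K$ be a finite field, let $D$ be a countable skew field that is a $\mathcal K$-algebra, let $\mathbb F_r$ be the free group on $r$ generators, and let $\varphi:\mathbb F_r\to D^\times$ be a generating homomorphism, i.e. no proper sub-skew-field of $D$ contains the image of the induced homomorphism $\varphi:\mathcal K\mathbb F_r\to D$ of the group algebra. A finite-dimensional representation is a homomorphism $\theta:\mathbb F_r\to GL(n,\mathcal K)$, $n\ge 1$, extended linearly to $\mathcal K\mathbb F_r\to \mathrm{Mat}_{n\times n}(\mathcal K)$. For $A\in\mathrm{Mat}_{m\times m}(\mathcal K\mathbb F_r)$ put $\mathrm{rk}_\theta(A)=\mathrm{Rank}(\theta(A))/n$, where $\theta(A)\in \mathrm{Mat}_{m\times m}(\mathrm{Mat}_{n\times n}(\mathcal K))\cong\mathrm{Mat}_{mn\times mn}(\mathcal K)$ is obtained by applying $\theta$ entrywise. A sequence $(\theta_k)_{k\ge 1}$ of finite-dimensional representations (of possibly different dimensions) is *convergent* if $\lim_{k}\mathrm{rk}_{\theta_k}(A)$ exists for all $m\ge 1$ and all $A\in\mathrm{Mat}_{m\times m}(\mathcal K\mathbb F_r)$; it *satisfies the Atiyah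 condition* if all these limits are integers; and $\varphi$ is a *limit* of $(\theta_k)$ if $\lim_{k}\mathrm{rk}_{\theta_k}(A)=\mathrm{rk}_D(\varphi(A))$ for all such $m$ and $A$, where $\mathrm{rk}_D$ is the usual (unnormalized) rank of an $m\times m$ matrix over the skew field $D$. For $M\in \mathrm{Mat}_{n\times n}(\mathcal K)$ write $\mathrm{rk}_n(M)=\mathrm{Rank}(M)/n$. A $\mathcal K$-algebra $R$ with a finite or countably infinite $\mathcal K$-basis $1=r_1,r_2,\dots$ is *(linearly) sofic* if there are a function $j:R\setminus\{0\}\to(0,\infty)$ and positive numbers $s_i\to 0$ such that for every $i\ge1$ there are $n_i\ge 1$ and a $\mathcal K$-linear map $\phi_i:R\to\mathrm{Mat}_{n_i\times n_i}(\mathcal K)$ with $\phi_i(1)=\mathrm{Id}$; $\mathrm{rk}_{n_i}(\phi_i(a))\ge j(a)$ for all $0\ne a\in\mathrm{Span}\{r_1,\dots,r_i\}$; and $\mathrm{rk}_{n_i}(\phi_i(ab)-\phi_i(a)\phi_i(b))<s_i$ for all $a,b\in\mathrm{Span}\{r_1,\dots,r_i\}$. (If $\dim R<i$, the span is $R$.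 The property does not depend on the choice of the basis.) **Theorem.** There exists a convergent sequence of finite-dimensional representations $(\theta_k)$ that satisfies the Atiyah condition and has $\varphi$ as a limit if and only if $D$ is sofic. -/

import Mathlib

open Filter Topology

noncomputable section

namespace LinSofic

/-- A finite-dimensional representation `F_r → Mat_{n×n}(K)` (`n ≥ 1`) of the free group on
`r` generators, i.e. a homomorphism into the invertible `n × n` matrices. -/
structure FinDimRep (K : Type*) [Field K] (r : ℕ) where
  dim : ℕ
  dim_pos : 0 < dim
  hom : FreeGroup (Fin r) →* (Matrix (Fin dim) (Fin dim) K)ˣ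

/-- The `K`-linear extension `K G → A` of a homomorphism `θ : G → Aˣ` to the group algebra. -/
def groupAlgebraExt (K : Type*) [Field K] {G A : Type*} [Group G] [Ring A] [Algebra K A]
    (θ : G →* Aˣ) : MonoidAlgebra K G →ₐ[K] A :=
  MonoidAlgebra.lift K A G ((Units.coeHom A).comp θ)

/-- The normalized rank `Rank(M) / n` of an `n × n` matrix over `K`. -/
def normRank {K : Type*} [Field K] {n : ℕ} (M : Matrix (Fin n) (Fin n) K) : ℝ :=
  (M.rank : ℝ) / (n : ℝ)

/-- For an `m × m` matrix `A` over `K F_r`, the number `Rank(θ(A)) / dim θ`, where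
`θ(A) ∈ Mat_{m×m}(Mat_{d×d}(K)) ≅ Mat_{md×md}(K)`, `d = dim θ`.
It takes the value `m` at the identity matrix. -/
def repRank {K : Type*} [Field K] {r : ℕ} (θ : FinDimRep K r) {m : ℕ}
    (A : Matrix (Fin m) (Fin m) (MonoidAlgebra K (FreeGroup (Fin r)))) : ℝ :=
  ((Matrix.comp (Fin m) (Fin m) (Fin θ.dim) (Fin θ.dim) K
    (A.map (groupAlgebraExt K θ.hom))).rank : ℝ) / (θ.dim : ℝ)

/-- The rank of a square matrix over a skew field: the dimension of the left vector space
spanned by its rows (equivalently, of the right vector space spanned by its columns). -/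
def skewRank {D : Type*} [DivisionRing D] {m : ℕ} (A : Matrix (Fin m) (Fin m) D) : ℕ :=
  Module.finrank D (Submodule.span D (Set.range A.row))

/-- Convergence of a sequence of finite-dimensional representations. -/
def IsConvergent {K : Type*} [Field K] {r : ℕ} (θ : ℕ → FinDimRep K r) : Prop :=
  ∀ m : ℕ, 1 ≤ m → ∀ A : Matrix (Fin m) (Fin m) (MonoidAlgebra K (FreeGroup (Fin r))),
    ∃ L : ℝ, Tendsto (fun k => repRank (θ k) A) atTop (𝓝 L)

/-- The Atiyah condition: all limits of matrix ranks are integers. -/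
def AtiyahCondition {K : Type*} [Field K] {r : ℕ} (θ : ℕ → FinDimRep K r) : Prop :=
  ∀ m : ℕ, 1 ≤ m → ∀ A : Matrix (Fin m) (Fin m) (MonoidAlgebra K (FreeGroup (Fin r))),
    ∃ z : ℤ, Tendsto (fun k => repRank (θ k) A) atTop (𝓝 (z : ℝ))

/-- The homomorphism `φ : F_r → Dˣ` into a skew field `D` over `K` is the limit of the
representations `θ k`. -/
def IsLimitRep {K : Type*} [Field K] {D : Type*} [DivisionRing D] [Algebra K D] {r : ℕ}
    (θ : ℕ → FinDimRep K r) (φ : FreeGroup (Fin r) →* Dˣ) : Prop :=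
  ∀ m : ℕ, 1 ≤ m → ∀ A : Matrix (Fin m) (Fin m) (MonoidAlgebra K (FreeGroup (Fin r))),
    Tendsto (fun k => repRank (θ k) A) atTop
      (𝓝 (skewRank (A.map (groupAlgebraExt K φ)) : ℝ))

/-- `φ : F_r → Dˣ` is generating: no proper sub-skew-field of `D` contains the image of the
group algebra `K F_r` (equivalently, contains both `K` and the image of `F_r`). -/
def IsGenerating (K : Type*) [Field K] {D : Type*} [DivisionRing D] [Algebra K D] {r : ℕ}
    (φ : FreeGroup (Fin r) →* Dˣ) : Prop :=
  Subfield.closure (Set.range (groupAlgebraExt K φ)) = ⊤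

/-- Soficity relative to a finite or infinite sequence `b 0, b 1, …` that is a basis of `R`
(`N` is the number of its terms). The span of the first `i` basis vectors is the span of
all of them when `R` has dimension less than `i`. -/
def IsSoficFor {K : Type*} [Field K] {R : Type*} [Ring R] [Algebra K R] {N : ℕ∞}
    (b : Module.Basis {t : ℕ // (t : ℕ∞) < N} K R) : Prop :=
  ∃ (j : R → ℝ) (s : ℕ → ℝ), (∀ a : R, a ≠ 0 → 0 < j a) ∧ (∀ i, 0 < s i) ∧
    Tendsto s atTop (𝓝 0) ∧
    ∀ i : ℕ, 1 ≤ i → ∃ n : ℕ, 1 ≤ n ∧ ∃ φ : R →ₗ[K] Matrix (Fin n) (Fin n) K,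
      φ 1 = 1 ∧
      (∀ a ∈ Submodule.span K (b '' {t | (t : ℕ) < i}), a ≠ 0 → j a ≤ normRank (φ a)) ∧
      (∀ a ∈ Submodule.span K (b '' {t | (t : ℕ) < i}),
        ∀ c ∈ Submodule.span K (b '' {t | (t : ℕ) < i}),
          normRank (φ (a * c) - φ a * φ c) < s i)

/-- A `K`-algebra is (linearly) sofic if it is sofic relative to some finite or countably
infinite basis whose first element is `1`. -/
def IsSofic (K : Type*) [Field K] (R : Type*) [Ring R] [Algebra K R] : Prop :=
  ∃ (N : ℕ∞) (h : ((0 : ℕ) : ℕ∞) < N) (b : Module.Basis {t : ℕ // (t : ℕ∞) < N} K R),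
    b ⟨0, h⟩ = 1 ∧ IsSoficFor b

end LinSofic

end

/-! Both conditions are equivalent to the existence of a `K`-algebra homomorphism from `D` to
`MatLim K n` for some positive sizes `n k`: the product of matrix algebras modulo sequences of
normalized rank tending to zero.

Soficity and homomorphisms. Almost multiplicative maps become multiplicative modulo null sequences
(`IsSofic.exists_algHom`). Conversely, a linear lift of a homomorphism is almost multiplicative, and
`a * a⁻¹ = 1` forces the rank of a nonzero `a` to tend to one; finiteness of `K` makes this uniform
on finite-dimensional spans (`isSofic_of_algHom`).

From homomorphisms to representations. Images of units of `D` lift to invertible sequences, and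
freeness turns lifts of the generators into representations. Rank factorization over `D` shows that
normalized ranks converge to ranks over `D` (`tendsto_seqRank_of_map_toLim_eq`).

From representations to homomorphisms. The `θ k` define a map from the group algebra to `MatLim`.
Since `φ` is generating, every element of `D` has the form `u A⁻¹ v` with entries from the group
algebra (Cohn's realizations). Convergence of ranks makes `A` invertible in `MatLim` and makes the
value of `u A⁻¹ v` there depend only on its value in `D` (`eq_zero_of_isRealization`), so the map
extends to `D` (`exists_ringHom_comp_eq`). -/

noncomputable section

namespace LinSofic

/-! ### Ranks of matrices over fields and skew fields -/

section MatrixRank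

variable {K : Type*} [Field K]

theorem rank_add_le {m n : Type*} [Finite m] [Fintype n] (A B : Matrix m n K) :
    (A + B).rank ≤ A.rank + B.rank := by
  rw [Matrix.rank, Matrix.mulVecLin_add]
  exact (Submodule.finrank_mono (LinearMap.range_add_le _ _)).trans
    (Submodule.finrank_add_le_finrank_add_finrank _ _)

variable {m n : Type*} [Fintype m] [Fintype n]

theorem rank_sum_le {ι : Type*} (s : Finset ι) (A : ι → Matrix m n K) :
    (∑ i ∈ s, A i).rank ≤ ∑ i ∈ s, (A i).rank := by
  classical
  induction s using Finset.induction_on with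
  | empty => simp
  | insert a s ha ih =>
    rw [Finset.sum_insert ha, Finset.sum_insert ha]
    exact (rank_add_le _ _).trans (by gcongr)

theorem rank_mul_mul_le {l o : Type*} [Fintype l] [Fintype o] (P : Matrix l m K)
    (A : Matrix m n K) (Q : Matrix n o K) : (P * A * Q).rank ≤ A.rank :=
  (Matrix.rank_mul_le_left _ _).trans (Matrix.rank_mul_le_right _ _)

/-- Every square matrix over a field differs from an invertible one by a matrix whose rank is
at most the corank. -/
theorem exists_unit_rank_sub_le [DecidableEq m] (X : Matrix m m K) :
    ∃ Y : (Matrix m m K)ˣ, (X - (Y : Matrix m m K)).rank + X.rank ≤ Fintype.card m := by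
  obtain ⟨V, U, e, ⟨V, rfl⟩, ⟨U, rfl⟩, h⟩ := Matrix.exists_rank_normal_form X
  refine ⟨V⁻¹ * U⁻¹, ?_⟩
  let c := Fintype.card m - X.rank
  have hX : X - ((V⁻¹ * U⁻¹ : (Matrix m m K)ˣ) : Matrix m m K) =
      (V⁻¹ : (Matrix m m K)ˣ) *
        ((V : Matrix m m K) * X * (U : Matrix m m K) - 1) * (U⁻¹ : (Matrix m m K)ˣ) := by
    simp [mul_sub, sub_mul, mul_assoc]
  -- In normal form the difference from the identity is `-1` on the corank block, so it factors
  -- through `K^c`.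
  have h1 : (V : Matrix m m K) * X * (U : Matrix m m K) - 1 =
      ((Matrix.fromRows (0 : Matrix (Fin X.rank) (Fin c) K) (1 : Matrix (Fin c) (Fin c) K)) *
        (Matrix.fromCols (0 : Matrix (Fin c) (Fin X.rank) K)
          (-1 : Matrix (Fin c) (Fin c) K))).submatrix e e := by
    rw [h, Matrix.fromRows_mul_fromCols, ← Matrix.submatrix_one_equiv e, ← Matrix.fromBlocks_one]
    ext i j
    simp only [Matrix.sub_apply, Matrix.submatrix_apply]
    rcases e i with a | a <;> rcases e j with b | b <;> simp
  have h2 : (X - ((V⁻¹ * U⁻¹ : (Matrix m m K)ˣ) : Matrix m m K)).rank ≤ c := by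
    rw [hX]
    refine (rank_mul_mul_le _ _ _).trans ?_
    rw [h1, Matrix.rank_submatrix]
    refine (Matrix.rank_mul_le_left _ _).trans ((Matrix.rank_le_card_width _).trans ?_)
    simp
  have h3 := Matrix.rank_le_card_width X
  omega

/-- Rank factorization of a matrix over a division ring. -/
theorem exists_rank_factorization {D : Type*} [DivisionRing D] [DecidableEq m] [DecidableEq n]
    (A : Matrix m n D) :
    ∃ k : ℕ, k = Module.finrank D (Submodule.span D (Set.range A.row)) ∧
      ∃ (C : Matrix m (Fin k) D) (R : Matrix (Fin k) n D) (L : Matrix (Fin k) m D)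
        (S : Matrix n (Fin k) D), A = C * R ∧ L * C = 1 ∧ R * S = 1 := by
  classical
  set W := Submodule.span D (Set.range A.row)
  refine ⟨_, rfl, ?_⟩
  set k := Module.finrank D W
  -- Acting on row vectors keeps everything left linear. The map factors through its image `W`; a
  -- section of the surjection gives `L`, a retraction of the inclusion gives `S`.
  let f : (m → D) →ₗ[D] (n → D) := Matrix.vecMulLinear A
  have hf : f = LinearMap.toMatrixRight'.symm A := rfl
  have hW : LinearMap.range f = W := by
    ext y
    rw [LinearMap.mem_range, Submodule.mem_span_range_iff_exists_fun]
    exact exists_congr fun c => by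
      rw [Matrix.vecMulLinear_apply, Matrix.vecMul_eq_sum]
      rfl
  let e : W ≃ₗ[D] (Fin k → D) := Module.finBasis D W |>.equivFun
  let p : (m → D) →ₗ[D] W := f.codRestrict W fun x => hW ▸ LinearMap.mem_range_self f x
  have hp : LinearMap.range p = ⊤ := by
    rw [LinearMap.range_eq_top]
    rintro ⟨y, hy⟩
    rw [← hW] at hy
    obtain ⟨x, rfl⟩ := hy
    exact ⟨x, rfl⟩
  obtain ⟨s, hs⟩ := p.exists_rightInverse_of_surjective hp
  obtain ⟨l, hl⟩ := W.subtype.exists_leftInverse_of_injective (Submodule.ker_subtype W)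
  refine ⟨LinearMap.toMatrixRight' (e.toLinearMap ∘ₗ p),
    LinearMap.toMatrixRight' (W.subtype ∘ₗ e.symm.toLinearMap),
    LinearMap.toMatrixRight' (s ∘ₗ e.symm.toLinearMap),
    LinearMap.toMatrixRight' (e.toLinearMap ∘ₗ l), ?_, ?_, ?_⟩
  · rw [← LinearMap.toMatrixRight'_comp, ← LinearEquiv.symm_apply_eq, ← hf]
    ext x
    simp [p]
  · rw [← LinearMap.toMatrixRight'_comp, ← LinearMap.toMatrixRight'_id]
    congr 1
    refine LinearMap.ext fun x => ?_
    have := LinearMap.congr_fun hs (e.symm x)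
    simp only [LinearMap.comp_apply, LinearMap.id_apply] at this
    simp [this]
  · rw [← LinearMap.toMatrixRight'_comp, ← LinearMap.toMatrixRight'_id]
    congr 1
    refine LinearMap.ext fun x => ?_
    have := LinearMap.congr_fun hl (e.symm x)
    simp only [LinearMap.comp_apply, LinearMap.id_apply] at this
    simp only [LinearMap.comp_apply, LinearEquiv.coe_coe, this]
    simp

theorem card_le_rank_of_mul_mul_eq_one {k : Type*} [Fintype k] [DecidableEq k]
    {P : Matrix k m K} {A : Matrix m n K} {Q : Matrix n k K} (h : P * A * Q = 1) :
    Fintype.card k ≤ A.rank := by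
  rw [← Matrix.rank_one (R := K) (n := k), ← h]
  exact rank_mul_mul_le _ _ _

/-- A rank factorization of `A` gives `L * A * S = 1` of size `A.rank`; bordering `L` and `S` by
identities exhibits an identity of the total size. -/
theorem card_add_rank_le_rank_fromBlocks [DecidableEq m] [DecidableEq n] (A : Matrix n n K) :
    Fintype.card m + A.rank ≤ (Matrix.fromBlocks (1 : Matrix m m K) 0 0 A).rank := by
  obtain ⟨k, hk, C, R, L, S, hA, hL, hR⟩ := exists_rank_factorization A
  have hk' : A.rank = k := by rw [hk, Matrix.rank_eq_finrank_span_row]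
  have := card_le_rank_of_mul_mul_eq_one (K := K) (k := m ⊕ Fin k)
    (P := Matrix.fromBlocks (1 : Matrix m m K) 0 0 L)
    (A := Matrix.fromBlocks (1 : Matrix m m K) 0 0 A)
    (Q := Matrix.fromBlocks (1 : Matrix m m K) 0 0 S) (by
      have : L * A * S = 1 := by
        rw [hA, ← Matrix.mul_assoc, hL, Matrix.one_mul, hR]
      have h1 := Matrix.fromBlocks_multiply (1 : Matrix m m K) 0 0 L (1 : Matrix m m K) 0 0 A
      have h2 := Matrix.fromBlocks_multiply (1 : Matrix m m K) 0 0 (L * A)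
        (1 : Matrix m m K) 0 0 S
      simp only [this, Matrix.mul_zero, Matrix.zero_mul, Matrix.one_mul, add_zero,
        zero_add] at h1 h2
      rw [h1, h2, Matrix.fromBlocks_one])
  simpa [hk'] using this

theorem finrank_span_row_mul_le {D : Type*} [DivisionRing D] {l : Type*} (C : Matrix l n D)
    {o : Type*} [Finite o] (R : Matrix n o D) :
    Module.finrank D (Submodule.span D (Set.range (C * R).row)) ≤ Fintype.card n := by
  refine le_trans (Submodule.finrank_mono (t := Submodule.span D (Set.range R.row)) ?_)
    (finrank_range_le_card (R := D) (M := o → D) R.row)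
  rw [Submodule.span_le]
  rintro _ ⟨i, rfl⟩
  have : (C * R).row i = ∑ j, C i j • R.row j := by
    ext t
    simp [Matrix.mul_apply, Matrix.row]
  rw [SetLike.mem_coe, this]
  exact Submodule.sum_mem _ fun j _ => Submodule.smul_mem _ _ (Submodule.subset_span ⟨j, rfl⟩)

theorem finrank_span_row_eq_card_of_isUnit {D : Type*} [DivisionRing D] [DecidableEq m]
    {A : Matrix m m D} (hA : IsUnit A) :
    Module.finrank D (Submodule.span D (Set.range A.row)) = Fintype.card m :=
  finrank_span_eq_card (Matrix.linearIndependent_rows_of_isUnit hA)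

end MatrixRank

/-! ### Realizations `u A⁻¹ v` and extension of homomorphisms to a skew field -/

section Realization

variable {R S : Type*} [Ring R] [Ring S]

theorem map_fromCols {ι κ : Type} (f : R →+* S) (u : Matrix Unit ι R) (u' : Matrix Unit κ R) :
    (Matrix.fromCols u u').map f = Matrix.fromCols (u.map f) (u'.map f) := by
  ext i j
  rcases j with j | j <;> rfl

theorem map_fromRows {ι κ : Type} (f : R →+* S) (v : Matrix ι Unit R) (v' : Matrix κ Unit R) :
    (Matrix.fromRows v v').map f = Matrix.fromRows (v.map f) (v'.map f) := by
  ext i j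
  rcases i with i | i <;> rfl

variable {ι κ : Type} [Fintype ι] [Fintype κ]
  [DecidableEq ι] [DecidableEq κ]

/-- The element `s` equals `u A⁻¹ v` after applying the ring homomorphism `f` to the entries. -/
def IsRealization (f : R →+* S) (A : Matrix ι ι R) (u : Matrix Unit ι R) (v : Matrix ι Unit R)
    (s : S) : Prop :=
  ∃ B : Matrix ι ι S, A.map f * B = 1 ∧ B * A.map f = 1 ∧
    u.map f * B * v.map f = Matrix.of fun _ _ => s

variable {f : R →+* S} {A : Matrix ι ι R} {u : Matrix Unit ι R} {v : Matrix ι Unit R} {s : S}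
  {A' : Matrix κ κ R} {u' : Matrix Unit κ R} {v' : Matrix κ Unit R} {s' : S}

theorem isRealization_apply (f : R →+* S) (a : R) :
    IsRealization f (1 : Matrix Unit Unit R) (Matrix.of fun _ _ => a) 1 (f a) := by
  refine ⟨1, by simp, by simp, ?_⟩
  ext
  simp

theorem IsRealization.neg (h : IsRealization f A u v s) : IsRealization f A (-u) v (-s) := by
  obtain ⟨B, h1, h2, h3⟩ := h
  refine ⟨B, h1, h2, ?_⟩
  have : (-u).map f = -u.map f := by ext; simp
  rw [this, Matrix.neg_mul, Matrix.neg_mul, h3]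
  rfl

theorem IsRealization.add (h : IsRealization f A u v s) (h' : IsRealization f A' u' v' s') :
    IsRealization f (Matrix.fromBlocks A 0 0 A') (Matrix.fromCols u u') (Matrix.fromRows v v')
      (s + s') := by
  obtain ⟨B, h1, h2, h3⟩ := h
  obtain ⟨B', h1', h2', h3'⟩ := h'
  refine ⟨Matrix.fromBlocks B 0 0 B', ?_, ?_, ?_⟩
  · simp [Matrix.fromBlocks_map, Matrix.fromBlocks_multiply, h1, h1']
  · simp [Matrix.fromBlocks_map, Matrix.fromBlocks_multiply, h2, h2']
  · simp only [map_fromCols, map_fromRows, Matrix.fromCols_mul_fromBlocks,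
      Matrix.fromCols_mul_fromRows, Matrix.mul_zero, add_zero, zero_add, h3, h3']
    rfl

/-- The off-diagonal block of the inverse of the triangular matrix is `B v u' B'`, which yields the
product of the two values. -/
theorem IsRealization.mul (h : IsRealization f A u v s) (h' : IsRealization f A' u' v' s') :
    IsRealization f (Matrix.fromBlocks A (-(v * u')) 0 A') (Matrix.fromCols u 0)
      (Matrix.fromRows 0 v') (s * s') := by
  obtain ⟨B, h1, h2, h3⟩ := h
  obtain ⟨B', h1', h2', h3'⟩ := h'
  have hneg : (-(v * u')).map f = -(v.map f * u'.map f) := by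
    rw [← Matrix.map_mul]
    exact Matrix.map_neg _ (map_neg f) _
  refine ⟨Matrix.fromBlocks B (B * (v.map f * u'.map f) * B') 0 B', ?_, ?_, ?_⟩
  · simp only [Matrix.fromBlocks_map, Matrix.fromBlocks_multiply, h1, h1', hneg,
      ← Matrix.mul_assoc, Matrix.one_mul]
    simp
  · simp only [Matrix.fromBlocks_map, Matrix.fromBlocks_multiply, h2, h2', hneg,
      Matrix.mul_assoc, Matrix.mul_one]
    simp
  · simp only [map_fromCols, map_fromRows, Matrix.fromCols_mul_fromBlocks,
      Matrix.fromCols_mul_fromRows]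
    have : u.map f * (B * (v.map f * u'.map f) * B') * v'.map f =
        (u.map f * B * v.map f) * (u'.map f * B' * v'.map f) := by
      simp only [Matrix.mul_assoc]
    simp only [Matrix.map_zero _ (map_zero f), Matrix.mul_zero, Matrix.zero_mul, add_zero,
      zero_add, this, h3, h3']
    ext
    simp [Matrix.mul_apply]

/-- The bordered matrix of a realization of a nonzero element of a division ring is invertible
and realizes the inverse. -/
theorem IsRealization.inv {D : Type*} [DivisionRing D] {f : R →+* D} {d : D}
    (h : IsRealization f A u v d) (hd : d ≠ 0) :
    IsRealization f (Matrix.fromBlocks A v u (0 : Matrix Unit Unit R))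
      (Matrix.fromCols 0 1) (Matrix.fromRows 0 (-1)) d⁻¹ := by
  obtain ⟨B, h1, h2, h3⟩ := h
  let c : Matrix Unit Unit D := Matrix.of fun _ _ => d
  let e : Matrix Unit Unit D := Matrix.of fun _ _ => d⁻¹
  have hce : c * e = 1 := by ext; simp [c, e, Matrix.mul_apply, hd]
  have hec : e * c = 1 := by ext; simp [c, e, Matrix.mul_apply, hd]
  change _ = c at h3
  generalize hA : A.map f = a at *
  generalize hu : u.map f = x at *
  generalize hv : v.map f = y at *
  -- Block inversion with Schur complement `-(x * B * y) = -c`, whose inverse is `-e`.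
  refine ⟨Matrix.fromBlocks (B - B * y * e * (x * B)) (B * y * e) (e * (x * B)) (-e), ?_, ?_, ?_⟩
  · rw [Matrix.fromBlocks_map, Matrix.fromBlocks_multiply, ← Matrix.fromBlocks_one, hA, hu, hv,
      Matrix.map_zero _ (map_zero f)]
    congr 1
    · simp only [Matrix.mul_sub, ← Matrix.mul_assoc, h1, Matrix.one_mul]
      abel
    · simp only [← Matrix.mul_assoc, h1, Matrix.one_mul, Matrix.mul_neg, add_neg_cancel]
    · simp only [Matrix.mul_sub, ← Matrix.mul_assoc, h3, hce, Matrix.one_mul, Matrix.zero_mul,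
        add_zero, sub_self]
    · simp only [← Matrix.mul_assoc, h3, hce, Matrix.zero_mul, add_zero]
  · rw [Matrix.fromBlocks_map, Matrix.fromBlocks_multiply, ← Matrix.fromBlocks_one, hA, hu, hv,
      Matrix.map_zero _ (map_zero f)]
    have h3' : x * (B * y) = c := by rw [← Matrix.mul_assoc, h3]
    congr 1
    · simp only [Matrix.sub_mul, Matrix.mul_assoc, h2, Matrix.mul_one]
      abel
    · simp only [Matrix.sub_mul, Matrix.mul_assoc, h3', hec, Matrix.mul_zero, Matrix.mul_one,
        add_zero, sub_self]
    · simp only [Matrix.mul_assoc, h2, Matrix.mul_one, Matrix.neg_mul, add_neg_cancel]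
    · simp only [Matrix.mul_assoc, h3', hec, Matrix.mul_zero, add_zero]
  · simp only [map_fromCols, map_fromRows, Matrix.fromCols_mul_fromBlocks,
      Matrix.fromCols_mul_fromRows]
    have : (-1 : Matrix Unit Unit R).map f = -1 := by ext; simp
    simp only [this, Matrix.map_zero _ (map_zero f), Matrix.map_one _ (map_zero f) (map_one f),
      Matrix.mul_zero, Matrix.zero_mul, Matrix.one_mul, zero_add, Matrix.mul_neg, Matrix.mul_one,
      neg_neg]
    rfl

theorem IsRealization.exists_of_isUnit (f : R →+* S) (u : Matrix Unit ι R) (v : Matrix ι Unit R)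
    (hA : IsUnit (A.map f)) : ∃ s, IsRealization f A u v s := by
  obtain ⟨U, hU⟩ := hA
  refine ⟨(u.map f * (↑U⁻¹ : Matrix ι ι S) * v.map f) () (), (↑U⁻¹ : Matrix ι ι S), ?_, ?_, ?_⟩
  · rw [← hU]; exact U.mul_inv
  · rw [← hU]; exact U.inv_mul
  · rfl

theorem IsRealization.isUnit (h : IsRealization f A u v s) : IsUnit (A.map f) := by
  obtain ⟨B, h1, h2, -⟩ := h
  exact ⟨⟨A.map f, B, h1, h2⟩, rfl⟩

/-- If `f : R → D` generates the division ring `D`, and `g : R → S` inverts the matrices that `f`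
inverts and annihilates the realizations that `f` annihilates, then `g` factors through `f`. -/
theorem exists_ringHom_comp_eq {D : Type*} [DivisionRing D] (f : R →+* D) (g : R →+* S)
    (hf : Subfield.closure (Set.range f) = ⊤)
    (hunit : ∀ (ι : Type) [Fintype ι] [DecidableEq ι] (A : Matrix ι ι R),
      IsUnit (A.map f) → IsUnit (A.map g))
    (hzero : ∀ (ι : Type) [Fintype ι] [DecidableEq ι] (A : Matrix ι ι R) (u : Matrix Unit ι R)
      (v : Matrix ι Unit R) (s : S), IsRealization f A u v 0 → IsRealization g A u v s → s = 0) :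
    ∃ h : D →+* S, h.comp f = g := by
  -- Pairs with a common realization. This subring turns out to be the graph of the desired
  -- homomorphism.
  let T : Subring (D × S) :=
    { carrier := {p | ∃ (ι : Type) (_ : Fintype ι) (_ : DecidableEq ι) (A : Matrix ι ι R)
        (u : Matrix Unit ι R) (v : Matrix ι Unit R),
        IsRealization f A u v p.1 ∧ IsRealization g A u v p.2}
      mul_mem' := by
        rintro _ _ ⟨ι, _, _, A, u, v, h1, h2⟩ ⟨κ, _, _, A', u', v', h1', h2'⟩
        exact ⟨_, _, _, _, _, _, h1.mul h1', h2.mul h2'⟩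
      one_mem' := ⟨Unit, inferInstance, inferInstance, 1, Matrix.of fun _ _ => 1, 1,
        by simpa using isRealization_apply f 1, by simpa using isRealization_apply g 1⟩
      add_mem' := by
        rintro _ _ ⟨ι, _, _, A, u, v, h1, h2⟩ ⟨κ, _, _, A', u', v', h1', h2'⟩
        exact ⟨_, _, _, _, _, _, h1.add h1', h2.add h2'⟩
      zero_mem' := ⟨Unit, inferInstance, inferInstance, 1, Matrix.of fun _ _ => 0, 1,
        by simpa using isRealization_apply f 0, by simpa using isRealization_apply g 0⟩
      neg_mem' := by
        rintro _ ⟨ι, _, _, A, u, v, h1, h2⟩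
        exact ⟨_, _, _, _, _, _, h1.neg, h2.neg⟩ }
  have hT : ∀ a, (f a, g a) ∈ T := fun a =>
    ⟨_, _, _, _, _, _, isRealization_apply f a, isRealization_apply g a⟩
  let p : T →+* D := (RingHom.fst D S).comp T.subtype
  -- Single-valuedness of the graph is exactly `hzero`, since differences of realizations are again
  -- realizations.
  have hinj : Function.Injective p := by
    rw [injective_iff_map_eq_zero]
    rintro ⟨⟨d, s⟩, ι, _, _, A, u, v, h1, h2⟩ (rfl : d = 0)
    exact Subtype.ext (Prod.ext rfl (hzero ι A u v s h1 h2))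
  -- The domain of the graph is closed under inverses: the bordered matrix is invertible over `D`,
  -- hence over `S` by `hunit`.
  let F : Subfield D :=
    { p.range with
      inv_mem' := by
        rintro _ ⟨⟨⟨d, s⟩, ι, _, _, A, u, v, h1, h2⟩, rfl⟩
        by_cases hd : d = 0
        · exact ⟨0, by simp [p, hd]⟩
        · have h3 := h1.inv hd
          obtain ⟨s', hs'⟩ := IsRealization.exists_of_isUnit g (Matrix.fromCols 0 1)
            (Matrix.fromRows 0 (-1)) (hunit _ _ h3.isUnit)
          exact ⟨⟨(d⁻¹, s'), _, _, _, _, _, _, h3, hs'⟩, rfl⟩ }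
  have hF : F = ⊤ := by
    rw [eq_top_iff, ← hf, Subfield.closure_le]
    rintro _ ⟨a, rfl⟩
    exact ⟨⟨_, hT a⟩, rfl⟩
  have hsurj : Function.Surjective p := fun d => by
    have : d ∈ F := hF ▸ Subfield.mem_top d
    exact this
  let e : T ≃+* D := RingEquiv.ofBijective p ⟨hinj, hsurj⟩
  refine ⟨((RingHom.snd D S).comp T.subtype).comp e.symm.toRingHom, ?_⟩
  ext a
  have : e.symm (f a) = ⟨_, hT a⟩ := by
    rw [RingEquiv.symm_apply_eq]
    rfl
  simp [this]

end Realization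

/-! ### Sequences of matrices modulo null sequences -/

section MatSeq

variable (K : Type*) [Field K] (n : ℕ → ℕ)

/-- Sequences of square matrices of sizes `n k`. -/
abbrev MatSeq := ∀ k, Matrix (Fin (n k)) (Fin (n k)) K

variable {K n}

theorem normRank_add_le {d : ℕ} (x y : Matrix (Fin d) (Fin d) K) :
    normRank (x + y) ≤ normRank x + normRank y := by
  unfold normRank
  rw [← add_div]
  gcongr
  exact_mod_cast rank_add_le x y

theorem normRank_mul_le_left {d : ℕ} (x y : Matrix (Fin d) (Fin d) K) :
    normRank (x * y) ≤ normRank x := by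
  unfold normRank
  gcongr
  exact Matrix.rank_mul_le_left x y

theorem normRank_mul_le_right {d : ℕ} (x y : Matrix (Fin d) (Fin d) K) :
    normRank (x * y) ≤ normRank y := by
  unfold normRank
  gcongr
  exact Matrix.rank_mul_le_right x y

theorem normRank_nonneg {d : ℕ} (x : Matrix (Fin d) (Fin d) K) : 0 ≤ normRank x := by
  unfold normRank
  positivity

variable (K n) in
/-- The ideal of sequences of matrices whose normalized rank tends to zero. -/
def nullIdeal : Ideal (MatSeq K n) where
  carrier := {x | Tendsto (fun k => normRank (x k)) atTop (𝓝 0)}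
  zero_mem' := by simp [normRank]
  add_mem' {x y} hx hy := by
    refine squeeze_zero (fun _ => normRank_nonneg _) (fun k => normRank_add_le (x k) (y k)) ?_
    simpa using Tendsto.add hx hy
  smul_mem' c x hx :=
    squeeze_zero (fun _ => normRank_nonneg _) (fun k => normRank_mul_le_right (c k) (x k)) hx

instance : (nullIdeal K n).IsTwoSided :=
  ⟨fun {x} c hx =>
    squeeze_zero (fun _ => normRank_nonneg _) (fun k => normRank_mul_le_left (x k) (c k)) hx⟩

variable (K n) in
/-- Sequences of matrices modulo those whose normalized rank tends to zero. -/
abbrev MatLim := MatSeq K n ⧸ nullIdeal K n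

variable (K n) in
/-- The quotient map to `MatLim K n`. -/
def toLim : MatSeq K n →ₐ[K] MatLim K n := Ideal.Quotient.mkₐ K (nullIdeal K n)

theorem toLim_surjective : Function.Surjective (toLim K n) :=
  Ideal.Quotient.mkₐ_surjective K _

theorem toLim_eq_zero {x : MatSeq K n} :
    toLim K n x = 0 ↔ Tendsto (fun k => normRank (x k)) atTop (𝓝 0) :=
  Ideal.Quotient.eq_zero_iff_mem

variable {ι κ o : Type*} [Fintype ι] [Fintype κ] [Fintype o]

/-- The `k`-th term of a matrix of sequences, as a matrix of scalars. -/
def level (X : Matrix ι κ (MatSeq K n)) (k : ℕ) : Matrix (ι × Fin (n k)) (κ × Fin (n k)) K :=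
  Matrix.of fun p q => X p.1 q.1 k p.2 q.2

/-- The normalized rank of the `k`-th term of a matrix of sequences. -/
def seqRank (X : Matrix ι κ (MatSeq K n)) (k : ℕ) : ℝ := ((level X k).rank : ℝ) / n k

omit [Fintype ι] [Fintype κ] in
theorem level_add (X Y : Matrix ι κ (MatSeq K n)) (k : ℕ) :
    level (X + Y) k = level X k + level Y k := rfl

omit [Fintype ι] [Fintype κ] in
theorem level_sub (X Y : Matrix ι κ (MatSeq K n)) (k : ℕ) :
    level (X - Y) k = level X k - level Y k := rfl

omit [Fintype ι] [Fintype o] in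
theorem level_mul (X : Matrix ι κ (MatSeq K n)) (Y : Matrix κ o (MatSeq K n)) (k : ℕ) :
    level (X * Y) k = level X k * level Y k := by
  ext p q
  simp [level, Matrix.mul_apply, Fintype.sum_prod_type, Finset.sum_apply, Matrix.sum_apply]

omit [Fintype ι] in
theorem level_one [DecidableEq ι] (k : ℕ) : level (1 : Matrix ι ι (MatSeq K n)) k = 1 := by
  ext ⟨i, a⟩ ⟨j, b⟩
  by_cases h : i = j <;> simp [level, Matrix.one_apply, h]

omit [Field K] [Fintype ι] [Fintype κ] in
theorem level_injective {X Y : Matrix ι κ (MatSeq K n)} (h : ∀ k, level X k = level Y k) :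
    X = Y := by
  ext i j k a b
  exact congrFun (congrFun (h k) (i, a)) (j, b)

omit [Fintype ι] in
theorem seqRank_nonneg (X : Matrix ι κ (MatSeq K n)) (k : ℕ) : 0 ≤ seqRank X k := by
  unfold seqRank
  positivity

theorem seqRank_le_add_sub (X Y : Matrix ι κ (MatSeq K n)) (k : ℕ) :
    seqRank X k ≤ seqRank Y k + seqRank (X - Y) k := by
  unfold seqRank
  rw [← add_div]
  gcongr
  have := rank_add_le (level Y k) (level (X - Y) k)
  rw [← level_add, add_sub_cancel] at this
  exact_mod_cast this

theorem seqRank_mul_mul_le {l : Type*} [Fintype l] (P : Matrix l ι (MatSeq K n))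
    (X : Matrix ι κ (MatSeq K n)) (Q : Matrix κ o (MatSeq K n)) (k : ℕ) :
    seqRank (P * X * Q) k ≤ seqRank X k := by
  unfold seqRank
  rw [level_mul, level_mul]
  gcongr
  exact rank_mul_mul_le _ _ _

omit [Fintype ι] in
theorem seqRank_mul_le_card (X : Matrix ι κ (MatSeq K n)) (Y : Matrix κ o (MatSeq K n)) (k : ℕ) :
    seqRank (X * Y) k ≤ Fintype.card κ := by
  unfold seqRank
  rw [level_mul]
  refine div_le_of_le_mul₀ (by positivity) (by positivity) ?_
  have := (Matrix.rank_mul_le_left (level X k) (level Y k)).trans (Matrix.rank_le_card_width _)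
  rw [Fintype.card_prod, Fintype.card_fin] at this
  exact_mod_cast this

theorem seqRank_one [DecidableEq ι] {k : ℕ} (hk : 0 < n k) :
    seqRank (1 : Matrix ι ι (MatSeq K n)) k = Fintype.card ι := by
  unfold seqRank
  rw [level_one, Matrix.rank_one, Fintype.card_prod, Fintype.card_fin]
  have : (n k : ℝ) ≠ 0 := by positivity
  push_cast
  field_simp

omit [Fintype ι] in
theorem normRank_apply_le_seqRank (X : Matrix ι κ (MatSeq K n)) (i : ι) (j : κ) (k : ℕ) :
    normRank (X i j k) ≤ seqRank X k := by
  unfold seqRank normRank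
  gcongr
  exact Matrix.rank_submatrix_le (level X k) (fun a => (i, a)) (fun b => (j, b))

theorem seqRank_le_sum (X : Matrix ι κ (MatSeq K n)) (k : ℕ) :
    seqRank X k ≤ ∑ i, ∑ j, normRank (X i j k) := by
  classical
  unfold seqRank normRank
  simp only [← Finset.sum_div]
  gcongr
  have h : level X k = ∑ i, ∑ j,
      (Matrix.of fun p a => if p = (i, a) then 1 else 0 : Matrix (ι × Fin (n k)) (Fin (n k)) K) *
        X i j k *
        (Matrix.of fun b q => if q = (j, b) then 1 else 0 :
          Matrix (Fin (n k)) (κ × Fin (n k)) K) := by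
    ext ⟨i, a⟩ ⟨j, b⟩
    simp [level, Matrix.sum_apply, Matrix.mul_apply, ite_and]
  rw [h]
  refine le_trans (Nat.cast_le.2 (rank_sum_le _ _)) ?_
  push_cast
  gcongr with i
  refine le_trans (Nat.cast_le.2 (rank_sum_le _ _)) ?_
  push_cast
  gcongr with j
  exact rank_mul_mul_le _ _ _

/-- Each entry has rank at most that of the whole matrix, which in turn is at most the sum over the
finitely many entries. -/
theorem map_toLim_eq_zero {X : Matrix ι κ (MatSeq K n)} :
    X.map (toLim K n) = 0 ↔ Tendsto (seqRank X) atTop (𝓝 0) := by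
  constructor
  · intro h
    refine squeeze_zero (seqRank_nonneg X) (seqRank_le_sum X) ?_
    have : ∀ i j, Tendsto (fun k => normRank (X i j k)) atTop (𝓝 0) := fun i j =>
      toLim_eq_zero.1 (congrFun (congrFun h i) j)
    simpa using tendsto_finsetSum Finset.univ fun i _ =>
      tendsto_finsetSum Finset.univ fun j _ => this i j
  · intro h
    ext i j
    exact toLim_eq_zero.2 (squeeze_zero (fun k => normRank_nonneg _)
      (normRank_apply_le_seqRank X i j) h)

theorem map_toLim_eq_iff {X Y : Matrix ι κ (MatSeq K n)} :
    X.map (toLim K n) = Y.map (toLim K n) ↔ Tendsto (seqRank (X - Y)) atTop (𝓝 0) := by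
  rw [← map_toLim_eq_zero, Matrix.map_sub _ (map_sub (toLim K n)), sub_eq_zero]

omit [Fintype ι] [Fintype κ] in
theorem exists_map_toLim_eq (Y : Matrix ι κ (MatLim K n)) :
    ∃ X : Matrix ι κ (MatSeq K n), X.map (toLim K n) = Y :=
  ⟨Matrix.of fun i j => (toLim_surjective (Y i j)).choose, by
    ext i j
    exact (toLim_surjective (Y i j)).choose_spec⟩

/-- A matrix of sequences of asymptotically full rank is invertible modulo null sequences. -/
theorem exists_unit_map_toLim_eq [DecidableEq ι] {X : Matrix ι ι (MatSeq K n)}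
    (hX : Tendsto (seqRank X) atTop (𝓝 (Fintype.card ι))) :
    ∃ Y : (Matrix ι ι (MatSeq K n))ˣ,
      (Y : Matrix ι ι (MatSeq K n)).map (toLim K n) = X.map (toLim K n) := by
  -- Each level is replaced by an invertible matrix at rank distance at most its corank, which is
  -- asymptotically negligible.
  choose Y hY using fun k => exists_unit_rank_sub_le (level X k)
  let Z : Matrix ι ι (MatSeq K n) := Matrix.of fun i j k => Matrix.of fun a b =>
    (Y k : Matrix _ _ K) (i, a) (j, b)
  let Z' : Matrix ι ι (MatSeq K n) := Matrix.of fun i j k => Matrix.of fun a b =>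
    (↑(Y k)⁻¹ : Matrix _ _ K) (i, a) (j, b)
  have hZ : ∀ k, level Z k = (Y k : Matrix _ _ K) := fun k => rfl
  have hZ' : ∀ k, level Z' k = (↑(Y k)⁻¹ : Matrix _ _ K) := fun k => rfl
  refine ⟨⟨Z, Z', level_injective fun k => ?_, level_injective fun k => ?_⟩, ?_⟩
  · rw [level_mul, level_one, hZ, hZ', Units.mul_inv]
  · rw [level_mul, level_one, hZ, hZ', Units.inv_mul]
  · symm
    change X.map (toLim K n) = Z.map (toLim K n)
    rw [map_toLim_eq_iff]
    have h0 : Tendsto (fun k => (Fintype.card ι : ℝ) - seqRank X k) atTop (𝓝 0) := by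
      simpa using hX.const_sub (Fintype.card ι : ℝ)
    refine squeeze_zero (seqRank_nonneg _) (fun k => ?_) h0
    rw [le_sub_iff_add_le]
    unfold seqRank
    rw [level_sub, hZ, ← add_div]
    refine div_le_of_le_mul₀ (by positivity) (by positivity) ?_
    have := hY k
    rw [Fintype.card_prod, Fintype.card_fin] at this
    exact_mod_cast this

theorem isUnit_map_toLim [DecidableEq ι] {X : Matrix ι ι (MatSeq K n)}
    (hX : Tendsto (seqRank X) atTop (𝓝 (Fintype.card ι))) : IsUnit (X.map (toLim K n)) := by
  obtain ⟨Y, hY⟩ := exists_unit_map_toLim_eq hX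
  rw [← hY]
  exact Y.isUnit.map (toLim K n).mapMatrix

theorem card_add_normRank_le_seqRank [DecidableEq ι] (x : MatSeq K n) {k : ℕ} (hk : 0 < n k) :
    Fintype.card ι + normRank (x k) ≤
      seqRank (Matrix.fromBlocks (1 : Matrix ι ι (MatSeq K n)) 0 0
        (Matrix.of fun _ _ : Unit => x)) k := by
  have hn : (0 : ℝ) < n k := by positivity
  unfold seqRank normRank
  rw [le_div_iff₀ hn, add_mul, div_mul_cancel₀ _ hn.ne']
  have h1 := card_add_rank_le_rank_fromBlocks (m := ι × Fin (n k)) (x k)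
  let e : (ι ⊕ Unit) × Fin (n k) ≃ (ι × Fin (n k)) ⊕ Fin (n k) :=
    (Equiv.sumProdDistrib _ _ _).trans ((Equiv.refl _).sumCongr (Equiv.punitProd _))
  have h2 : level (Matrix.fromBlocks (1 : Matrix ι ι (MatSeq K n)) 0 0
      (Matrix.of fun _ _ : Unit => x)) k =
      (Matrix.fromBlocks (1 : Matrix (ι × Fin (n k)) (ι × Fin (n k)) K) 0 0 (x k)).submatrix
        e e := by
    rw [← level_one]
    ext ⟨i | i, a⟩ ⟨j | j, b⟩ <;> rfl
  rw [h2, Matrix.rank_submatrix]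
  rw [Fintype.card_prod, Fintype.card_fin] at h1
  exact_mod_cast h1

/-- The rank of a matrix over a division ring embedded in `MatLim K n` is the limit of the
normalized ranks of a lift. -/
theorem tendsto_seqRank_of_map_toLim_eq {D : Type*} [DivisionRing D] (hn : ∀ k, 0 < n k)
    (h : D →+* MatLim K n) {X : Matrix ι κ (MatSeq K n)} {B : Matrix ι κ D}
    (hX : X.map (toLim K n) = B.map h) :
    Tendsto (seqRank X) atTop
      (𝓝 (Module.finrank D (Submodule.span D (Set.range B.row)) : ℝ)) := by
  classical
  -- Lifting `B = C * R` bounds the rank above by `d`, and lifting `L * B * S = 1` bounds it below,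
  -- both up to null sequences.
  obtain ⟨d, hd, C, R, L, S, hB, hL, hR⟩ := exists_rank_factorization B
  rw [← hd]
  obtain ⟨C', hC'⟩ := exists_map_toLim_eq (C.map h)
  obtain ⟨R', hR'⟩ := exists_map_toLim_eq (R.map h)
  obtain ⟨L', hL'⟩ := exists_map_toLim_eq (L.map h)
  obtain ⟨S', hS'⟩ := exists_map_toLim_eq (S.map h)
  have h1 : X.map (toLim K n) = (C' * R').map (toLim K n) := by
    rw [Matrix.map_mul, hC', hR', hX, hB, Matrix.map_mul]
  have h2 : (1 : Matrix (Fin d) (Fin d) (MatSeq K n)).map (toLim K n) =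
      (L' * X * S').map (toLim K n) := by
    have : L * B * S = 1 := by
      rw [hB, ← Matrix.mul_assoc, hL, Matrix.one_mul, hR]
    rw [Matrix.map_mul, Matrix.map_mul, hL', hX, hS', ← Matrix.map_mul, ← Matrix.map_mul, this,
      Matrix.map_one _ (map_zero _) (map_one _), Matrix.map_one _ (map_zero _) (map_one _)]
  rw [map_toLim_eq_iff] at h1 h2
  refine tendsto_of_tendsto_of_tendsto_of_le_of_le
    (g := fun k => (d : ℝ) - seqRank (1 - L' * X * S') k)
    (h := fun k => (d : ℝ) + seqRank (X - C' * R') k) ?_ ?_ (fun k => ?_) (fun k => ?_)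
  · simpa using h2.const_sub (d : ℝ)
  · simpa using h1.const_add (d : ℝ)
  · have h3 := seqRank_le_add_sub 1 (L' * X * S') k
    rw [seqRank_one (hn k), Fintype.card_fin] at h3
    have h4 := seqRank_mul_mul_le L' X S' k
    dsimp only
    linarith
  · have h3 := seqRank_le_add_sub X (C' * R') k
    have h4 := seqRank_mul_le_card C' R' k
    rw [Fintype.card_fin] at h4
    dsimp only
    linarith

end MatSeq

/-! ### Soficity and homomorphisms to `MatLim` -/

section SoficHom

variable {K : Type*} [Field K]

theorem exists_equiv_initial_segment {α : Type*} [Countable α] (a : α) :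
    ∃ (N : ℕ∞) (h : ((0 : ℕ) : ℕ∞) < N) (e : α ≃ {t : ℕ // (t : ℕ∞) < N}), e a = ⟨0, h⟩ := by
  classical
  obtain ⟨N, ⟨e⟩⟩ : ∃ N : ℕ∞, Nonempty (α ≃ {t : ℕ // (t : ℕ∞) < N}) := by
    rcases finite_or_infinite α with hα | hα
    · refine ⟨(Nat.card α : ℕ∞), ⟨(Finite.equivFin α).trans (Fin.equivSubtype.trans ?_)⟩⟩
      exact Equiv.subtypeEquivRight fun t => by simp
    · obtain ⟨d⟩ := nonempty_denumerable α
      exact ⟨⊤, ⟨(Denumerable.eqv α).trans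
        (Equiv.subtypeUnivEquiv fun t => ENat.natCast_lt_top t).symm⟩⟩
  have h : ((0 : ℕ) : ℕ∞) < N := lt_of_le_of_lt (by simp) (e a).2
  exact ⟨N, h, e.trans (Equiv.swap (e a) ⟨0, h⟩), by simp⟩

theorem exists_basis_initial_segment (K : Type*) [Field K] (R : Type*) [Ring R] [Nontrivial R]
    [Algebra K R] [Countable R] :
    ∃ (N : ℕ∞) (h : ((0 : ℕ) : ℕ∞) < N) (b : Module.Basis {t : ℕ // (t : ℕ∞) < N} K R),
      b ⟨0, h⟩ = 1 := by
  have hs : LinearIndepOn K id ({1} : Set R) := LinearIndepOn.singleton (by simp)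
  have h1 : (1 : R) ∈ hs.extend (Set.subset_univ _) := hs.subset_extend _ rfl
  obtain ⟨N, h, e, he⟩ :=
    exists_equiv_initial_segment (⟨1, h1⟩ : hs.extend (Set.subset_univ _))
  refine ⟨N, h, (Module.Basis.extend hs).reindex e, ?_⟩
  rw [Module.Basis.reindex_apply, ← he, Equiv.symm_apply_apply, Module.Basis.extend_apply_self]

/-- A homomorphism from a countable division algebra into `MatLim K n` makes it sofic. -/
theorem isSofic_of_algHom [Finite K] {D : Type*} [DivisionRing D] [Algebra K D] [Countable D]
    {n : ℕ → ℕ} (hn : ∀ k, 0 < n k) (h : D →ₐ[K] MatLim K n) : IsSofic K D := by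
  classical
  obtain ⟨N, hN, b, hb⟩ := exists_basis_initial_segment K D
  -- Any constant below one would serve as `j`, since normalized ranks of nonzero elements tend to
  -- one.
  refine ⟨N, hN, b, hb, fun _ => 1 / 2, fun i => 1 / ((i : ℝ) + 1), fun _ _ => by norm_num,
    fun i => by positivity, tendsto_one_div_add_atTop_nhds_zero_nat, fun i _ => ?_⟩
  -- The first basis vector is sent to `1` itself, because `φ 1 = 1` is required exactly and not
  -- just modulo null sequences.
  let Φ : D →ₗ[K] MatSeq K n :=
    b.constr K fun t => if t = ⟨0, hN⟩ then 1 else (toLim_surjective (h (b t))).choose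
  have hΦ1 : Φ 1 = 1 := by
    rw [← hb, Module.Basis.constr_basis, if_pos rfl]
  have hΦ : ∀ a, toLim K n (Φ a) = h a := by
    intro a
    have : (toLim K n).toLinearMap ∘ₗ Φ = h.toLinearMap := by
      refine b.ext fun t => ?_
      simp only [LinearMap.comp_apply, Φ, Module.Basis.constr_basis, AlgHom.toLinearMap_apply]
      split_ifs with ht
      · rw [ht, hb, map_one, map_one]
      · exact (toLim_surjective (h (b t))).choose_spec
    exact LinearMap.congr_fun this a
  set V := Submodule.span K (b '' {t | (t : ℕ) < i})
  -- Over a finite field the span is a finite set, so a single level satisfies all the eventual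
  -- conditions at once.
  have hfin : Finite V := by
    have : (b '' {t | (t : ℕ) < i}).Finite :=
      ((Set.finite_lt_nat i).preimage Subtype.val_injective.injOn).image b
    have := FiniteDimensional.span_of_finite K this
    exact Module.finite_of_finite K
  have hrank : ∀ a : V, ∀ᶠ k in atTop, (a : D) ≠ 0 → 1 / 2 ≤ normRank (Φ a k) := by
    intro a
    by_cases ha : (a : D) = 0
    · exact Eventually.of_forall fun k hk => absurd ha hk
    · have h1 : Tendsto (fun k => normRank ((1 - Φ a * Φ (a : D)⁻¹) k)) atTop (𝓝 0) := by
        rw [← toLim_eq_zero, map_sub, map_mul, hΦ, hΦ, ← map_mul, mul_inv_cancel₀ ha, map_one,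
          map_one, sub_self]
      filter_upwards [h1.eventually (gt_mem_nhds (by norm_num : (0 : ℝ) < 1 / 2))] with k hk _
      have h2 := normRank_add_le (Φ a k * Φ (a : D)⁻¹ k) ((1 - Φ a * Φ (a : D)⁻¹) k)
      have h3 := normRank_mul_le_left (Φ a k) (Φ (a : D)⁻¹ k)
      have h4 : Φ a k * Φ (a : D)⁻¹ k + (1 - Φ a * Φ (a : D)⁻¹) k = 1 := by
        simp
      have h5 : normRank (1 : Matrix (Fin (n k)) (Fin (n k)) K) = 1 := by
        have : (n k : ℝ) ≠ 0 := by exact_mod_cast (hn k).ne'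
        simp [normRank, this]
      rw [h4, h5] at h2
      linarith
  have hmul : ∀ p : V × V, ∀ᶠ k in atTop,
      normRank (Φ (p.1 * p.2 : D) k - Φ p.1 k * Φ p.2 k) < 1 / ((i : ℝ) + 1) := by
    intro p
    have h1 : Tendsto (fun k => normRank ((Φ (p.1 * p.2 : D) - Φ p.1 * Φ p.2) k)) atTop (𝓝 0) := by
      rw [← toLim_eq_zero, map_sub, map_mul (toLim K n), hΦ, hΦ, hΦ, map_mul, sub_self]
    exact h1.eventually (gt_mem_nhds (by positivity))
  obtain ⟨k, hk1, hk2⟩ := ((eventually_all.2 hrank).and (eventually_all.2 hmul)).exists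
  refine ⟨n k, hn k, (LinearMap.proj k).comp Φ, ?_, fun a ha ha0 => hk1 ⟨a, ha⟩ ha0,
    fun a ha c hc => hk2 (⟨a, ha⟩, ⟨c, hc⟩)⟩
  change Φ 1 k = 1
  rw [hΦ1]
  rfl

theorem exists_mem_span_initial_segment {R : Type*} [Ring R] [Algebra K R] {N : ℕ∞}
    (b : Module.Basis {t : ℕ // (t : ℕ∞) < N} K R) (a : R) :
    ∃ M : ℕ, ∀ i, M ≤ i → a ∈ Submodule.span K (b '' {t | (t : ℕ) < i}) := by
  refine ⟨(b.repr a).support.sup (fun t => (t : ℕ)) + 1, fun i hi => ?_⟩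
  rw [b.mem_span_image]
  intro t ht
  have := Finset.le_sup (f := fun t : {t : ℕ // (t : ℕ∞) < N} => (t : ℕ)) ht
  exact lt_of_lt_of_le (Nat.lt_succ_of_le this) hi

/-- A sofic algebra maps homomorphically to some `MatLim K n`. -/
theorem IsSofic.exists_algHom {R : Type*} [Ring R] [Algebra K R] (hR : IsSofic K R) :
    ∃ n : ℕ → ℕ, (∀ k, 0 < n k) ∧ Nonempty (R →ₐ[K] MatLim K n) := by
  obtain ⟨N, _, b, _, j, s, _, _, hs, H⟩ := hR
  -- Soficity is indexed from one and sequences from zero, hence the shift.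
  choose n hn φ hφ1 _ hφ using fun k : ℕ => H (k + 1) (Nat.le_add_left 1 k)
  refine ⟨n, hn, ⟨AlgHom.ofLinearMap ((toLim K n).toLinearMap ∘ₗ LinearMap.pi φ) ?_ ?_⟩⟩
  · have : LinearMap.pi φ 1 = (1 : MatSeq K n) := funext hφ1
    rw [LinearMap.comp_apply, this, AlgHom.toLinearMap_apply, map_one]
  · intro a c
    simp only [LinearMap.comp_apply, AlgHom.toLinearMap_apply]
    rw [← sub_eq_zero, ← map_mul, ← map_sub, toLim_eq_zero]
    obtain ⟨M, hM⟩ := exists_mem_span_initial_segment b a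
    obtain ⟨M', hM'⟩ := exists_mem_span_initial_segment b c
    refine squeeze_zero' (Eventually.of_forall fun k => normRank_nonneg _) ?_
      (hs.comp (tendsto_add_atTop_nat 1))
    filter_upwards [eventually_ge_atTop M, eventually_ge_atTop M'] with k hk hk'
    exact (hφ k a (hM _ (by omega)) c (hM' _ (by omega))).le

end SoficHom

/-! ### Limits of representations and homomorphisms to `MatLim` -/

section Representations

variable {K : Type*} [Field K] {r : ℕ}

theorem groupAlgebraExt_unitsMap_comp {G A B : Type*} [Group G] [Ring A] [Algebra K A] [Ring B]
    [Algebra K B] (F : A →ₐ[K] B) (η : G →* Aˣ) :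
    groupAlgebraExt K ((Units.map (F : A →* B)).comp η) = F.comp (groupAlgebraExt K η) := by
  apply MonoidAlgebra.algHom_ext
  · intro g
    simp [groupAlgebraExt]
  · ext

/-- As a `1 × 1` matrix, `d` has rank one, so any lift has asymptotically full rank and can be
corrected to a unit. -/
theorem exists_unit_toLim_eq {D : Type*} [DivisionRing D] {n : ℕ → ℕ} (hn : ∀ k, 0 < n k)
    (h : D →+* MatLim K n) (d : Dˣ) : ∃ y : (MatSeq K n)ˣ, toLim K n y = h d := by
  let B : Matrix Unit Unit D := Matrix.of fun _ _ => (d : D)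
  have hB : IsUnit B := d.isUnit.map (Matrix.uniqueRingEquiv (m := Unit) (A := D)).symm
  obtain ⟨X, hX⟩ := exists_map_toLim_eq (B.map h)
  have hX' := tendsto_seqRank_of_map_toLim_eq hn h hX
  rw [finrank_span_row_eq_card_of_isUnit hB] at hX'
  obtain ⟨Y, hY⟩ := exists_unit_map_toLim_eq hX'
  refine ⟨Units.map (Matrix.uniqueRingEquiv (m := Unit) (A := MatSeq K n) :
    Matrix Unit Unit (MatSeq K n) →* MatSeq K n) Y, ?_⟩
  exact congrFun (congrFun (hY.trans hX) ()) ()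

theorem exists_isLimitRep_of_algHom {D : Type*} [DivisionRing D] [Algebra K D] {n : ℕ → ℕ}
    (hn : ∀ k, 0 < n k) (h : D →ₐ[K] MatLim K n) (φ : FreeGroup (Fin r) →* Dˣ) :
    ∃ θ : ℕ → FinDimRep K r, IsLimitRep θ φ := by
  choose y hy using fun s => exists_unit_toLim_eq hn (h : D →+* MatLim K n) (φ (FreeGroup.of s))
  -- Freeness is used here: independently chosen lifts of the generators satisfy no relations, so
  -- they define an exact homomorphism.
  let η : FreeGroup (Fin r) →* (MatSeq K n)ˣ := FreeGroup.lift y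
  have hη : (Units.map (toLim K n : MatSeq K n →* MatLim K n)).comp η =
      (Units.map (h : D →* MatLim K n)).comp φ := by
    ext s
    simpa [η] using hy s
  let ev : ∀ k, MatSeq K n →ₐ[K] Matrix (Fin (n k)) (Fin (n k)) K := fun k =>
    Pi.evalAlgHom K (fun k => Matrix (Fin (n k)) (Fin (n k)) K) k
  let θ : ℕ → FinDimRep K r := fun k =>
    ⟨n k, hn k, (Units.map (ev k : MatSeq K n →* _)).comp η⟩
  refine ⟨θ, fun m _ A => ?_⟩
  have h1 : (A.map (groupAlgebraExt K η)).map (toLim K n) =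
      (A.map (groupAlgebraExt K φ)).map (h : D →+* MatLim K n) := by
    have h2 := groupAlgebraExt_unitsMap_comp (toLim K n) η
    rw [hη, groupAlgebraExt_unitsMap_comp] at h2
    ext i j : 2
    exact (DFunLike.congr_fun h2 (A i j)).symm
  have h3 : ∀ k, repRank (θ k) A = seqRank (A.map (groupAlgebraExt K η)) k := by
    intro k
    have h4 : groupAlgebraExt K (θ k).hom = (ev k).comp (groupAlgebraExt K η) :=
      groupAlgebraExt_unitsMap_comp (ev k) η
    unfold repRank
    rw [h4]
    rfl
  simp only [h3]
  exact tendsto_seqRank_of_map_toLim_eq hn (h : D →+* MatLim K n) h1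

variable {D : Type*} [DivisionRing D] [Algebra K D] {φ : FreeGroup (Fin r) →* Dˣ}
  {θ : ℕ → FinDimRep K r}

/-- The homomorphism from the group algebra to sequences of matrices given by a sequence of
representations. -/
def seqRep (θ : ℕ → FinDimRep K r) :
    MonoidAlgebra K (FreeGroup (Fin r)) →ₐ[K] MatSeq K (fun k => (θ k).dim) :=
  AlgHom.pi fun k => groupAlgebraExt K (θ k).hom

theorem tendsto_seqRank_seqRep (hθ : IsLimitRep θ φ) {ι : Type*} [Fintype ι]
    (A : Matrix ι ι (MonoidAlgebra K (FreeGroup (Fin r)))) :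
    Tendsto (seqRank (A.map (seqRep θ))) atTop
      (𝓝 (skewRank ((A.map (groupAlgebraExt K φ)).submatrix (Fintype.equivFin ι).symm
        (Fintype.equivFin ι).symm) : ℝ)) := by
  have h1 : ∀ k, seqRank (A.map (seqRep θ)) k =
      repRank (θ k) (A.submatrix (Fintype.equivFin ι).symm (Fintype.equivFin ι).symm) := by
    intro k
    unfold seqRank repRank
    congr 2
    rw [← Matrix.rank_submatrix _ ((Fintype.equivFin ι).symm.prodCongr (Equiv.refl _))
      ((Fintype.equivFin ι).symm.prodCongr (Equiv.refl _))]
    rfl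
  -- `IsLimitRep` only concerns `m ≥ 1`; for an empty index type both ranks vanish.
  rcases Nat.eq_zero_or_pos (Fintype.card ι) with h0 | h0
  · have : IsEmpty ι := Fintype.card_eq_zero_iff.1 h0
    have h2 : ∀ k, seqRank (A.map (seqRep θ)) k = 0 := fun k => by
      have : (level (A.map (seqRep θ)) k).rank ≤ 0 := by
        simpa using Matrix.rank_le_card_width (level (A.map (seqRep θ)) k)
      simp [seqRank, Nat.le_zero.1 this]
    have h3 : skewRank ((A.map (groupAlgebraExt K φ)).submatrix (Fintype.equivFin ι).symm
        (Fintype.equivFin ι).symm) ≤ 0 := by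
      refine (finrank_range_le_card (R := D) ((A.map (groupAlgebraExt K φ)).submatrix
        (Fintype.equivFin ι).symm (Fintype.equivFin ι).symm).row).trans ?_
      simp
    rw [Nat.le_zero.1 h3]
    simp [funext h2]
  · simp only [funext h1]
    exact hθ _ h0 _

theorem isUnit_map_toLim_seqRep (hθ : IsLimitRep θ φ) {ι : Type*} [Fintype ι] [DecidableEq ι]
    {A : Matrix ι ι (MonoidAlgebra K (FreeGroup (Fin r)))}
    (hA : IsUnit (A.map (groupAlgebraExt K φ))) :
    IsUnit ((A.map (seqRep θ)).map (toLim K _)) := by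
  refine isUnit_map_toLim ?_
  have h := tendsto_seqRank_seqRep hθ A
  have h1 : IsUnit ((A.map (groupAlgebraExt K φ)).submatrix (Fintype.equivFin ι).symm
      (Fintype.equivFin ι).symm) :=
    hA.map (Matrix.reindexRingEquiv D (Fintype.equivFin ι))
  rwa [skewRank, finrank_span_row_eq_card_of_isUnit h1, Fintype.card_fin] at h

/-- The bordered matrix `M` detects the value through its Schur complement. Over `D` the value is
`0`, so `M` has rank at most `card ι`; over `MatLim` it reduces to `diag(1, -q)`, of asymptotic rank
`card ι` plus that of `-q`. Equality of limits leaves no rank for `q`. -/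
theorem eq_zero_of_isRealization (hθ : IsLimitRep θ φ) {ι : Type} [Fintype ι] [DecidableEq ι]
    {A : Matrix ι ι (MonoidAlgebra K (FreeGroup (Fin r)))} {u : Matrix Unit ι _}
    {v : Matrix ι Unit _} {q : MatLim K (fun k => (θ k).dim)}
    (hD : IsRealization (groupAlgebraExt K φ : _ →+* D) A u v 0)
    (hq : IsRealization ((toLim K _).comp (seqRep θ) : _ →+* MatLim K (fun k => (θ k).dim))
      A u v q) : q = 0 := by
  obtain ⟨B, h1, h2, h3⟩ := hD
  obtain ⟨C, h1', h2', h3'⟩ := hq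
  set f : MonoidAlgebra K (FreeGroup (Fin r)) →+* D := RingHomClass.toRingHom (groupAlgebraExt K φ)
  set g : MonoidAlgebra K (FreeGroup (Fin r)) →+* MatLim K (fun k => (θ k).dim) :=
    RingHomClass.toRingHom ((toLim K _).comp (seqRep θ))
  set M := Matrix.fromBlocks A v u (0 : Matrix Unit Unit _)
  have hM := tendsto_seqRank_seqRep hθ M
  set L := skewRank ((M.map (groupAlgebraExt K φ)).submatrix
    (Fintype.equivFin (ι ⊕ Unit)).symm (Fintype.equivFin (ι ⊕ Unit)).symm)
  have hL : L ≤ Fintype.card ι := by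
    -- As `u A⁻¹ v = 0`, the matrix factors through `D^ι`.
    have h4 : M.map (groupAlgebraExt K φ) =
        Matrix.fromRows (A.map f) (u.map f) * Matrix.fromCols 1 (B * v.map f) := by
      rw [Matrix.fromRows_mul_fromCols, Matrix.mul_one, Matrix.mul_one, ← Matrix.mul_assoc,
        ← Matrix.mul_assoc, h1, h3, Matrix.one_mul]
      simp only [M, Matrix.fromBlocks_map, Matrix.map_zero _ (map_zero _)]
      rfl
    simp only [L]
    rw [h4, Matrix.submatrix_mul _ _ _ id _ Function.bijective_id]
    exact finrank_span_row_mul_le _ _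
  -- Block elimination of the row `u` and the column `v`.
  have hred : Matrix.fromBlocks C 0 (-(u.map g * C)) (1 : Matrix Unit Unit _) * M.map g *
      Matrix.fromBlocks 1 (-(C * v.map g)) 0 1 =
      Matrix.fromBlocks 1 0 0 (Matrix.of fun _ _ => -q) := by
    have h5 : (Matrix.of fun _ _ : Unit => -q) = -(u.map g * C * v.map g) := by
      rw [h3']
      rfl
    rw [h5]
    simp only [M, Matrix.fromBlocks_map, Matrix.fromBlocks_multiply, Matrix.map_zero _ (map_zero g),
      Matrix.mul_one, Matrix.mul_zero, Matrix.zero_mul, Matrix.one_mul, add_zero, zero_add, h2',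
      Matrix.neg_mul, Matrix.mul_assoc, neg_add_cancel]
  obtain ⟨P, hP⟩ := exists_map_toLim_eq
    (Matrix.fromBlocks C 0 (-(u.map g * C)) (1 : Matrix Unit Unit _))
  obtain ⟨P', hP'⟩ := exists_map_toLim_eq
    (Matrix.fromBlocks (1 : Matrix ι ι _) (-(C * v.map g)) 0 (1 : Matrix Unit Unit _))
  obtain ⟨x, hx⟩ := toLim_surjective (-q)
  have h6 : (Matrix.fromBlocks (1 : Matrix ι ι _) 0 0 (Matrix.of fun _ _ : Unit => x)).map
      (toLim K fun k => (θ k).dim) = (P * M.map (seqRep θ) * P').map (toLim K _) := by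
    rw [Matrix.map_mul, Matrix.map_mul, hP, hP', Matrix.map_map]
    refine Eq.trans ?_ hred.symm
    rw [Matrix.fromBlocks_map, Matrix.map_zero _ (map_zero _), Matrix.map_zero _ (map_zero _),
      Matrix.map_one _ (map_zero _) (map_one _), ← hx]
    rfl
  rw [map_toLim_eq_iff] at h6
  rw [← neg_eq_zero, ← hx, toLim_eq_zero]
  have h7 := (hM.sub_const (L : ℝ)).add h6
  rw [sub_self, add_zero] at h7
  refine squeeze_zero (fun k => normRank_nonneg _) (fun k => ?_) h7
  have h8 := card_add_normRank_le_seqRank (ι := ι) x (k := k) (θ k).dim_pos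
  have h9 := seqRank_le_add_sub
    (Matrix.fromBlocks (1 : Matrix ι ι _) 0 0 (Matrix.of fun _ _ : Unit => x))
    (P * M.map (seqRep θ) * P') k
  have h10 := seqRank_mul_mul_le P (M.map (seqRep θ)) P' k
  have h11 : (L : ℝ) ≤ Fintype.card ι := by exact_mod_cast hL
  linarith

theorem IsLimitRep.exists_algHom (hφ : IsGenerating K φ) (hθ : IsLimitRep θ φ) :
    Nonempty (D →ₐ[K] MatLim K (fun k => (θ k).dim)) := by
  let f : MonoidAlgebra K (FreeGroup (Fin r)) →+* D :=
    RingHomClass.toRingHom (groupAlgebraExt K φ)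
  let g : MonoidAlgebra K (FreeGroup (Fin r)) →+* MatLim K (fun k => (θ k).dim) :=
    RingHomClass.toRingHom ((toLim K _).comp (seqRep θ))
  have hf : Subfield.closure (Set.range f) = ⊤ := hφ
  have hunit : ∀ (ι : Type) [Fintype ι] [DecidableEq ι]
      (A : Matrix ι ι (MonoidAlgebra K (FreeGroup (Fin r)))),
      IsUnit (A.map f) → IsUnit (A.map g) := fun ι _ _ A hA => isUnit_map_toLim_seqRep hθ hA
  obtain ⟨h, hh⟩ := exists_ringHom_comp_eq f g hf hunit
    fun ι _ _ A u v s h1 h2 => eq_zero_of_isRealization hθ h1 h2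
  refine ⟨{ h with commutes' := fun c => ?_ }⟩
  have h1 := RingHom.congr_fun hh (algebraMap K _ c)
  have h2 : f (algebraMap K _ c) = algebraMap K D c := (groupAlgebraExt K φ).commutes c
  have h3 : g (algebraMap K _ c) = algebraMap K _ c := ((toLim K _).comp (seqRep θ)).commutes c
  rw [RingHom.comp_apply, h2, h3] at h1
  exact h1

end Representations

end LinSofic

end

theorem mainTheorem4 (K : Type*) [Field K] [Finite K] (D : Type*) [DivisionRing D]
    [Algebra K D] [Countable D] (r : ℕ) (φ : FreeGroup (Fin r) →* Dˣ)
    (hφ : LinSofic.IsGenerating K φ) :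
    (∃ θ : ℕ → LinSofic.FinDimRep K r,
      LinSofic.IsConvergent θ ∧ LinSofic.AtiyahCondition θ ∧ LinSofic.IsLimitRep θ φ) ↔
    LinSofic.IsSofic K D := by
  constructor
  · rintro ⟨θ, -, -, hθ⟩
    obtain ⟨h⟩ := hθ.exists_algHom hφ
    exact LinSofic.isSofic_of_algHom (fun k => (θ k).dim_pos) h
  · intro hD
    obtain ⟨n, hn, ⟨h⟩⟩ := hD.exists_algHom
    obtain ⟨θ, hθ⟩ := LinSofic.exists_isLimitRep_of_algHom hn h φ
    -- Convergence and the Atiyah condition are immediate: the limits are ranks over `D`, hence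
    -- natural numbers.
    exact ⟨θ, fun m hm A => ⟨_, hθ m hm A⟩, fun m hm A => ⟨_, by exact_mod_cast hθ m hm A⟩, hθ⟩
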